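/- **Setting.** A labelled stochastic transition system (LSTS) $\mathcal T=(S,\Sigma,\kappa,\mathsf{AP},\mathcal L)$ consists of a measurable space $(S,\Sigma)$, a Markov kernel $\kappa$ from $S$ to $S$, a finite set $\mathsf{AP}$ and a measurable map $\mathcal L:S\to 2^{\mathsf{AP}}$. For a probability measure $\mu$ on $S$, $\mathbb P^{\mathcal T}_\mu$ is the law on $S^{\mathbb N}$ of the Markov chain with initial distribution $\mu$ and kernel $\kappa$, and $\Omega_{\mathcal T}(\mu)(A)=\int\kappa(s,A)\,\mu(ds)$. Write $\mathbf F B$ for the set of paths that visit $B$. A set $B\in\Sigma$ is an attractor if $\mathbb P^{\mathcal T}_\mu(\mathbf F B)=1$ for every probability measure $\mu$ on $S$. $\mathcal T$ is a DMC if $S$ is countable and $\Sigma=2^S$; in a DMC, a path from $s$ to $t$ is a finite sequence of states from $s$ to $t$ (possibly of length $0$) whose steps all have positive probability. For a measurable $\alpha:S_1\to S_2$, $\mathcal T_2$ is an $\alpha$-abstraction of $\mathcal T_1$ if for every probability measure $\mu$ on $S_1$ the measures $\alpha_\#(\Omega_{\mathcal T_1}(\mu))$ and $\Omega_{\mathcal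 T_2}(\alpha_\#\mu)$ have the same null sets; for LSTSs over the same $\mathsf{AP}$ one also requires $\mathcal L_2\circ\alpha=\mathcal L_1$. It is sound if moreover, for all probability measures $\mu$ on $S_1$ and all $B\in\Sigma_2$, $\mathbb P^{\mathcal T_2}_{\alpha_\#\mu}(\mathbf F B)=1$ implies $\mathbb P^{\mathcal T_1}_{\mu}(\mathbf F\alpha^{-1}(B))=1$. A deterministic Muller automaton $\mathcal M=(Q,q_0,E,\mathcal F)$ over $\mathsf{AP}$ has a finite set $Q$ of locations, $q_0\in Q$, $E\subseteq Q\times 2^{\mathsf{AP}}\times Q$ such that for all $(q,u)$ there is exactly one $q'$ with $(q,u,q')\in E$, and $\mathcal F\subseteq 2^Q$. The product $\mathcal T\ltimes\mathcal M$ has state space $S\times Q$ (with the product $\sigma$-algebra $\Sigma\otimes 2^Q$), kernel $\kappa'((s,q),A\times\{q'\})=\kappa(s,A)$ if $(q,\mathcal L(s),q')\in E$ and $0$ otherwise, and the state $(s,q)$ is labelled by $q$. For a path $\rho$ of the product, $\mathsf{Inf}(\rho)\subseteq Q$ is the set of locations visited infinitely often. Put $\alpha_{\mathcal M}(s,q)=(\alpha(s),q)$.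 For a DMC $\mathcal T$ and a finite attractor $B$ of $\mathcal T\ltimes\mathcal M$, let $\mathsf{Graph}(B)$ be the directed graph with vertex set $B$ and an edge from $x$ to $y$ whenever there is a path from $x$ to $y$ in $\mathcal T\ltimes\mathcal M$. A bottom strongly connected component (BSCC) is a strongly connected component that no edge leaves. A BSCC $C$ of $\mathsf{Graph}(B)$ is good for $\mathcal F$ if there is $F\in\mathcal F$ such that (a) whenever there is a path in $\mathcal T\ltimes\mathcal M$ from an element of $C$ to $(s,q)$, then $q\in F$; and (b) for every $q\in F$ there are $s\in S$ and a path from an element of $C$ to $(s,q)$. Let $\mathsf{Good}^{B}_{\mathcal T\ltimes\mathcal M}(\mathcal F)$ be the set of these. **Theorem.** Let $\mathcal T_1,\mathcal T_2$ be LSTSs over the same $\mathsf{AP}$ such that $\mathcal T_2$ is a DMC with a finite attractor and is an $\alpha$-abstraction of $\mathcal T_1$. Let $\mathcal M=(Q,q_0,E,\mathcal F)$ be a deterministic Muller automaton over $\mathsf{AP}$. Assume that $\mathcal T_2\ltimes\mathcal M$ is a sound $\alpha_{\mathcal M}$-abstraction of $\mathcal T_1\ltimes\mathcal M$, and let $B_2$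 be a finite attractor of $\mathcal T_2\ltimes\mathcal M$. Then for every probability measure $\mu$ on $S_1$, $$\mathbb P^{\mathcal T_1\ltimes\mathcal M}_{\mu\times\delta_{q_0}}(\mathsf{Inf}\in\mathcal F)=\sum_{C\in\mathsf{Good}^{B_2}_{\mathcal T_2\ltimes\mathcal M}(\mathcal F)}\mathbb P^{\mathcal T_1\ltimes\mathcal M}_{\mu\times\delta_{q_0}}\bigl(\mathbf F\,\alpha_{\mathcal M}^{-1}(C)\bigr).$$ -/

import Mathlib

open MeasureTheory ProbabilityTheory

/-- A stochastic transition system on the measurable space `S`: a Markov kernel from `S` to `S`. -/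
structure STS (S : Type*) [MeasurableSpace S] where
  kernel : Kernel S S
  markov : IsMarkovKernel kernel

namespace STS

variable {S : Type*} [MeasurableSpace S]

instance instMarkovKernel (T : STS S) : IsMarkovKernel T.kernel := T.markov

/-- The kernel giving the next state from a history of states: it only looks at the last state. -/
noncomputable def stepKernel (T : STS S) (n : ℕ) :
    Kernel (Π _ : Finset.Iic n, S) S :=
  T.kernel.comap (fun x => x ⟨n, Finset.mem_Iic.2 le_rfl⟩) (measurable_pi_apply _)

instance instMarkovStep (T : STS S) (n : ℕ) : IsMarkovKernel (T.stepKernel n) := by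
  unfold stepKernel; infer_instance

/-- The law on infinite paths `ℕ → S` (with the `σ`-algebra generated by the cylinders) of the
system started from the initial distribution `μ`. -/
noncomputable def pathMeasure (T : STS S) (μ : Measure S) : Measure (ℕ → S) :=
  Kernel.trajMeasure (X := fun _ : ℕ => S) μ T.stepKernel

/-- One step of the system as a transformer of distributions:
`transform T μ A = ∫ κ(s, A) μ(ds)`. -/
noncomputable def transform (T : STS S) (μ : Measure S) : Measure S :=
  μ.bind T.kernel

/-- `B` is an attractor: from every initial distribution, `B` is reached almost surely. -/
def IsAttractor (T : STS S) (B : Set S) : Prop :=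
  MeasurableSet B ∧
    ∀ μ : Measure S, IsProbabilityMeasure μ → T.pathMeasure μ {ρ | ∃ n, ρ n ∈ B} = 1

/-- There is a finite path from `s` to `t`, each of whose steps has positive probability
(meant for denumerable state spaces with the discrete `σ`-algebra). -/
def HasPath (T : STS S) (s t : S) : Prop :=
  Relation.ReflTransGen (fun x y => 0 < T.kernel x {y}) s t

/-- The graph whose vertices are the elements of `B`, with an edge from `x` to `y` if there is a
path from `x` to `y` in the system. -/
def graph (T : STS S) (B : Set S) : Digraph B where
  Adj x y := T.HasPath x y

end STS

/-- Two measures have the same measurable null sets. -/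
def QualEquiv {S : Type*} [MeasurableSpace S] (μ ν : Measure S) : Prop :=
  ∀ A, MeasurableSet A → (μ A = 0 ↔ ν A = 0)

/-- `T₂` is an `α`-abstraction of `T₁`. -/
def STS.IsAbstraction {S₁ S₂ : Type*} [MeasurableSpace S₁] [MeasurableSpace S₂]
    (α : S₁ → S₂) (T₁ : STS S₁) (T₂ : STS S₂) : Prop :=
  Measurable α ∧ ∀ μ : Measure S₁, IsProbabilityMeasure μ →
    QualEquiv ((T₁.transform μ).map α) (T₂.transform (μ.map α))

/-- `T₂` is a sound `α`-abstraction of `T₁`: it is an `α`-abstraction, and almost sure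
reachability of `B` in `T₂` implies almost sure reachability of `α⁻¹(B)` in `T₁`, from every
initial distribution. -/
def STS.IsSoundAbstraction {S₁ S₂ : Type*} [MeasurableSpace S₁] [MeasurableSpace S₂]
    (α : S₁ → S₂) (T₁ : STS S₁) (T₂ : STS S₂) : Prop :=
  STS.IsAbstraction α T₁ T₂ ∧
    ∀ μ : Measure S₁, IsProbabilityMeasure μ → ∀ B : Set S₂, MeasurableSet B →
      T₂.pathMeasure (μ.map α) {ρ | ∃ n, ρ n ∈ B} = 1 →
        T₁.pathMeasure μ {ρ | ∃ n, ρ n ∈ α ⁻¹' B} = 1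

/-- A strongly connected component of a directed graph: a class of mutually reachable vertices. -/
def Digraph.IsSCC {V : Type*} (G : Digraph V) (C : Set V) : Prop :=
  ∃ v, C = {w | Relation.ReflTransGen G.Adj v w ∧ Relation.ReflTransGen G.Adj w v}

/-- A bottom strongly connected component: one that no edge leaves. -/
def Digraph.IsBSCC {V : Type*} (G : Digraph V) (C : Set V) : Prop :=
  G.IsSCC C ∧ ∀ x ∈ C, ∀ y, G.Adj x y → y ∈ C

/-- A labelled stochastic transition system with atomic propositions `AP` (finite in all uses, so
that the `σ`-algebra of `Set AP` is the full power set). -/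
structure LSTS (AP S : Type*) [MeasurableSpace S] extends STS S where
  label : S → Set AP
  measurable_label : Measurable label

/-- The set of atomic propositions that hold infinitely often along a path. -/
def LSTS.inf {AP S : Type*} [MeasurableSpace S] (T : LSTS AP S) (ρ : ℕ → S) : Set AP :=
  {a | {j : ℕ | a ∈ T.label (ρ j)}.Infinite}

/-- `α`-abstraction for labelled systems over the same atomic propositions. -/
structure LSTS.IsAbstraction {AP S₁ S₂ : Type*} [MeasurableSpace S₁] [MeasurableSpace S₂]
    (α : S₁ → S₂) (T₁ : LSTS AP S₁) (T₂ : LSTS AP S₂) : Prop where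
  sts : STS.IsAbstraction α T₁.toSTS T₂.toSTS
  label_closed : ∀ s s', α s = α s' → T₁.label s = T₁.label s'
  label_eq : ∀ s, T₂.label (α s) = T₁.label s

/-- A deterministic (and complete) Muller automaton over `AP` with set of locations `Q`. -/
structure DMA (AP Q : Type*) where
  init : Q
  edges : Set (Q × Set AP × Q)
  muller : Set (Set Q)
  deterministic : ∀ q u q₁ q₂, (q, u, q₁) ∈ edges → (q, u, q₂) ∈ edges → q₁ = q₂
  complete : ∀ q u, ∃ q', (q, u, q') ∈ edges

/-- The unique location `q'` such that `(q, u, q')` is an edge. -/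
noncomputable def DMA.next {AP Q : Type*} (M : DMA AP Q) (q : Q) (u : Set AP) : Q :=
  (M.complete q u).choose

/-- The lifting `(s, q) ↦ (α s, q)`. -/
def liftProd {S₁ S₂ : Type*} (Q : Type*) (α : S₁ → S₂) (x : S₁ × Q) : S₂ × Q :=
  (α x.1, x.2)

section Product

variable {AP S Q : Type*} [MeasurableSpace S] [Finite AP] [Finite Q] [MeasurableSpace Q]
  [DiscreteMeasurableSpace Q]

theorem LSTS.measurable_next (T : LSTS AP S) (M : DMA AP Q) :
    Measurable (fun x : S × Q => M.next x.2 (T.label x.1)) := by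
  have h : Measurable (fun p : Q × Set AP => M.next p.1 p.2) := Measurable.of_discrete
  exact h.comp (measurable_snd.prodMk (T.measurable_label.comp measurable_fst))

/-- The product of a labelled system with a Muller automaton: from `(s, q)` the first component
moves according to `κ(s, ·)`, the second one moves to the location `q'` with
`(q, label s, q') ∈ E`. The state `(s, q)` is labelled by `q`. -/
noncomputable def LSTS.product (T : LSTS AP S) (M : DMA AP Q) : LSTS Q (S × Q) where
  kernel := (Kernel.prodMkRight Q T.kernel) ×ₖ
    (Kernel.deterministic (fun x : S × Q => M.next x.2 (T.label x.1)) (T.measurable_next M))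
  markov := inferInstance
  label x := {x.2}
  measurable_label :=
    (Measurable.of_discrete (f := fun q : Q => ({q} : Set Q))).comp measurable_snd

end Product

/-- The BSCCs `C` of the graph of `B` (as sets of states) which are good for the Muller condition
`𝓕`: some `F ∈ 𝓕` consists exactly of the locations that are reachable from `C`. -/
def goodBSCCs {S Q : Type*} [MeasurableSpace S] [MeasurableSpace Q] (T : STS (S × Q))
    (B : Set (S × Q)) (𝓕 : Set (Set Q)) : Set (Set (S × Q)) :=
  {C | (∃ D : Set B, (T.graph B).IsBSCC D ∧ C = Subtype.val '' D) ∧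
    ∃ F ∈ 𝓕,
      (∀ s q, (∃ c ∈ C, T.HasPath c (s, q)) → q ∈ F) ∧
      (∀ q ∈ F, ∃ s, ∃ c ∈ C, T.HasPath c (s, q))}

/-! Only qualitative information passes between the two systems. Almost every path of the first
product maps under `liftProd Q α` to a path of the second with steps of positive probability
(`IsAbstraction.ae_hasPath`), since null successors pull back to null sets.

In the second product, the finite attractor makes the union of the BSCCs almost surely reached
(`ae_hits_sUnion_bsccs`). From any state reachable from a BSCC, every state reachable from that BSCC
is almost surely hit (`ae_hits_of_mem_bsccs`). Both facts come from a maximum principle for the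
probability of avoiding a set (`ae_hits_of_finite_isAttractor`). Soundness carries them to the first
product, and the Markov property makes the second one hold at all times
(`IsSoundAbstraction.ae_hits`), so hits recur infinitely often.

Hence almost every path meets a BSCC, and its `inf` is exactly the set of locations reachable from
that BSCC (`ae_inf_eq_reachableLocations`). Up to null sets, the Muller event is therefore the
disjoint union of the events of meeting a good BSCC. -/

namespace STS

/-! ### Path measures and the Markov property -/

section Markov

variable {S : Type*} [MeasurableSpace S] (T : STS S)

theorem pathMeasure_dirac (x : S) :
    T.pathMeasure (Measure.dirac x) = Kernel.traj (X := fun _ : ℕ => S) T.stepKernel 0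
      ((MeasurableEquiv.piUnique (fun _ : Finset.Iic 0 => S)).symm x) := by
  unfold pathMeasure Kernel.trajMeasure
  erw [Measure.map_dirac' (MeasurableEquiv.measurable _),
    Measure.dirac_bind (Kernel.measurable _)]

/-- The kernel sending a state to the law of the paths that start in it. -/
noncomputable def pathKernel : Kernel S (ℕ → S) where
  toFun x := T.pathMeasure (Measure.dirac x)
  measurable' := by
    simp_rw [pathMeasure_dirac]
    exact (Kernel.measurable _).comp (MeasurableEquiv.measurable _)

theorem pathKernel_apply (x : S) : T.pathKernel x = T.pathMeasure (Measure.dirac x) := rfl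

theorem pathMeasure_eq_bind (μ : Measure S) : T.pathMeasure μ = μ.bind T.pathKernel := by
  ext s hs
  rw [Measure.bind_apply hs (Kernel.aemeasurable _)]
  simp_rw [pathKernel_apply, pathMeasure_dirac]
  unfold pathMeasure Kernel.trajMeasure
  rw [Measure.bind_apply hs (Kernel.aemeasurable _)]
  erw [lintegral_map (Kernel.measurable_coe _ hs) (MeasurableEquiv.measurable _)]

instance isProbabilityMeasure_pathMeasure (μ : Measure S) [IsProbabilityMeasure μ] :
    IsProbabilityMeasure (T.pathMeasure μ) := by
  unfold pathMeasure; infer_instance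

instance isProbabilityMeasure_transform (μ : Measure S) [IsProbabilityMeasure μ] :
    IsProbabilityMeasure (T.transform μ) := by
  unfold transform; infer_instance

theorem transform_dirac (x : S) : T.transform (Measure.dirac x) = T.kernel x :=
  Measure.dirac_bind (Kernel.measurable _) _

theorem pathMeasure_apply (μ : Measure S) {A : Set (ℕ → S)} (hA : MeasurableSet A) :
    T.pathMeasure μ A = ∫⁻ x, T.pathMeasure (Measure.dirac x) A ∂μ := by
  rw [pathMeasure_eq_bind, Measure.bind_apply hA (Kernel.aemeasurable _)]
  rfl

/-- The conditional law of the state at time `a + 1` given the states up to time `a`. -/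
theorem pathMeasure_frestrictLe_succ (μ : Measure S) [IsProbabilityMeasure μ] (a : ℕ)
    {A : Set ((Π _ : Finset.Iic a, S) × S)} (hA : MeasurableSet A) :
    T.pathMeasure μ {ρ | (Preorder.frestrictLe (π := fun _ : ℕ => S) a ρ, ρ (a + 1)) ∈ A} =
      ∫⁻ ρ, T.kernel (ρ a) {y | (Preorder.frestrictLe (π := fun _ : ℕ => S) a ρ, y) ∈ A}
        ∂(T.pathMeasure μ) := by
  have h := congrArg (fun ν => ν A)
    (Kernel.map_frestrictLe_trajMeasure_compProd_eq_map_trajMeasure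
      (X := fun _ : ℕ => S) (μ₀ := μ) (κ := T.stepKernel) (a := a))
  rw [Measure.map_apply (by fun_prop) hA, Measure.compProd_apply hA,
    lintegral_map (Kernel.measurable_kernel_prodMk_left hA) (by fun_prop)] at h
  exact h.symm

theorem pathMeasure_map_zero (μ : Measure S) [IsProbabilityMeasure μ] :
    (T.pathMeasure μ).map (fun ρ => ρ 0) = μ := by
  have key : ∀ x, (T.pathMeasure (Measure.dirac x)).map (fun ρ => ρ 0) = Measure.dirac x := by
    intro x
    rw [pathMeasure_dirac]
    have h := Kernel.traj_map_frestrictLe_apply (X := fun _ : ℕ => S) (κ := T.stepKernel) 0 0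
      ((MeasurableEquiv.piUnique (fun _ : Finset.Iic 0 => S)).symm x)
    rw [Kernel.partialTraj_self, Kernel.id_apply] at h
    have h2 := congrArg (fun ν => ν.map (fun y : (Π _ : Finset.Iic 0, S) =>
      y ⟨0, Finset.mem_Iic.2 le_rfl⟩)) h
    rw [Measure.map_map (by fun_prop) (by fun_prop), Measure.map_dirac' (by fun_prop)] at h2
    exact h2
  ext A hA
  rw [Measure.map_apply (by fun_prop) hA, pathMeasure_apply _ _ (by measurability)]
  have : ∀ x, T.pathMeasure (Measure.dirac x) ((fun ρ => ρ 0) ⁻¹' A) = A.indicator 1 x := by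
    intro x
    rw [← Measure.map_apply (by fun_prop) hA, key, Measure.dirac_apply' _ hA]
  simp_rw [this]
  exact lintegral_indicator_one hA

theorem pathMeasure_map_one (μ : Measure S) [IsProbabilityMeasure μ] :
    (T.pathMeasure μ).map (fun ρ => ρ 1) = T.transform μ := by
  ext A hA
  rw [Measure.map_apply (by fun_prop) hA]
  have h := T.pathMeasure_frestrictLe_succ μ 0 (A := Prod.snd ⁻¹' A) (measurable_snd hA)
  refine h.trans ?_
  have h0 := T.pathMeasure_map_zero μ
  simp only [Set.mem_preimage, Set.ofPred_mem_eq]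
  rw [transform, Measure.bind_apply hA (Kernel.aemeasurable _)]
  conv_rhs => rw [← h0]
  rw [lintegral_map (Kernel.measurable_coe _ hA) (by fun_prop)]

/-- A law on paths is determined by its initial distribution and its one-step conditional laws. -/
theorem eq_pathMeasure (μ : Measure S) [IsProbabilityMeasure μ] (ν : Measure (ℕ → S))
    [IsProbabilityMeasure ν] (h0 : ν.map (fun ρ => ρ 0) = μ)
    (hs : ∀ (a : ℕ) (A : Set ((Π _ : Finset.Iic a, S) × S)), MeasurableSet A →
      ν {ρ | (Preorder.frestrictLe (π := fun _ : ℕ => S) a ρ, ρ (a + 1)) ∈ A} =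
      ∫⁻ ρ, T.kernel (ρ a) {y | (Preorder.frestrictLe (π := fun _ : ℕ => S) a ρ, y) ∈ A} ∂ν) :
    ν = T.pathMeasure μ := by
  have key : ∀ a, ν.map (Preorder.frestrictLe (π := fun _ : ℕ => S) a) =
      (T.pathMeasure μ).map (Preorder.frestrictLe (π := fun _ : ℕ => S) a) := by
    intro a
    induction a with
    | zero =>
      have hc : Preorder.frestrictLe (π := fun _ : ℕ => S) 0 =
          (fun x (_ : Finset.Iic 0) => x) ∘ (fun ρ => ρ 0) := by
        ext ρ ⟨i, hi⟩
        have : i = 0 := by simpa using hi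
        subst this
        rfl
      rw [hc, ← Measure.map_map (by fun_prop) (by fun_prop),
        ← Measure.map_map (by fun_prop) (by fun_prop), h0, pathMeasure_map_zero]
    | succ a ih =>
      -- `g` appends the next state to a history, so the law up to time `a + 1` is the image of a
      -- joint law fixed by the law up to `a` and the one-step kernel.
      let g : (Π _ : Finset.Iic a, S) × S → (Π _ : Finset.Iic (a + 1), S) := fun p i =>
        if h : i.1 ≤ a then p.1 ⟨i.1, Finset.mem_Iic.2 h⟩ else p.2
      have hg : Measurable g := by
        refine measurable_pi_lambda _ fun i => ?_
        by_cases h : i.1 ≤ a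
        · simp only [g, h, dif_pos]; fun_prop
        · simp only [g, h, dif_neg, not_false_eq_true]; fun_prop
      have hc : Preorder.frestrictLe (π := fun _ : ℕ => S) (a + 1) =
          g ∘ (fun ρ => (Preorder.frestrictLe (π := fun _ : ℕ => S) a ρ, ρ (a + 1))) := by
        ext ρ ⟨i, hi⟩
        by_cases h : i ≤ a
        · simp [g, h]
        · have : i = a + 1 := by have := Finset.mem_Iic.1 hi; omega
          subst this
          simp [g]
      rw [hc, ← Measure.map_map hg (by fun_prop), ← Measure.map_map hg (by fun_prop)]
      congr 1
      ext A hA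
      rw [Measure.map_apply (by fun_prop) hA, Measure.map_apply (by fun_prop) hA]
      refine (hs a A hA).trans (Eq.trans ?_ (T.pathMeasure_frestrictLe_succ μ a hA).symm)
      have hm : Measurable fun x : (Π _ : Finset.Iic a, S) =>
          T.stepKernel a x (Prod.mk x ⁻¹' A) := Kernel.measurable_kernel_prodMk_left hA
      have := congrArg (fun ν => ∫⁻ x, T.stepKernel a x (Prod.mk x ⁻¹' A) ∂ν) ih
      simp only at this
      rw [lintegral_map hm (by fun_prop), lintegral_map hm (by fun_prop)] at this
      exact this
  -- Every finite set of times lies in an initial segment, so agreement on initial segments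
  -- determines the law.
  refine IsProjectiveLimit.unique (P := fun I => ν.map I.restrict) (fun I => rfl) fun I => ?_
  have hI : I ⊆ Finset.Iic (I.sup id) := fun i hi => Finset.mem_Iic.2 (Finset.le_sup (f := id) hi)
  have hc : I.restrict (π := fun _ : ℕ => S) = Finset.restrict₂ (π := fun _ : ℕ => S) hI ∘
      Preorder.frestrictLe (π := fun _ : ℕ => S) (I.sup id) := rfl
  have hr : Measurable (Finset.restrict₂ (π := fun _ : ℕ => S) hI) := Finset.measurable_restrict₂ _
  change (T.pathMeasure μ).map I.restrict = ν.map I.restrict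
  rw [hc, ← Measure.map_map hr (by fun_prop), ← Measure.map_map hr (by fun_prop), key]

/-- The Markov property: after one step, a path is distributed as one of the system started from
the distribution of the next state. -/
theorem pathMeasure_map_shift (μ : Measure S) [IsProbabilityMeasure μ] :
    (T.pathMeasure μ).map (fun ρ n => ρ (n + 1)) = T.pathMeasure (T.transform μ) := by
  have hm : Measurable fun (ρ : ℕ → S) n => ρ (n + 1) := by fun_prop
  have : IsProbabilityMeasure ((T.pathMeasure μ).map (fun ρ n => ρ (n + 1))) :=
    Measure.isProbabilityMeasure_map hm.aemeasurable
  refine T.eq_pathMeasure _ _ ?_ fun a A hA => ?_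
  · rw [Measure.map_map (by fun_prop) hm]
    exact T.pathMeasure_map_one μ
  · have hf : Measurable fun ρ : ℕ → S =>
        (Preorder.frestrictLe (π := fun _ : ℕ => S) a ρ, ρ (a + 1)) := by fun_prop
    have hfA : MeasurableSet
        {ρ : ℕ → S | (Preorder.frestrictLe (π := fun _ : ℕ => S) a ρ, ρ (a + 1)) ∈ A} := hf hA
    rw [Measure.map_apply hm hfA, lintegral_map _ hm]
    -- `g` forgets the state at time 0: the one-step law of the shifted path at time `a` is that of
    -- the original path at time `a + 1`.
    · let g : (Π _ : Finset.Iic (a + 1), S) × S → (Π _ : Finset.Iic a, S) × S := fun p =>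
        (fun i => p.1 ⟨i.1 + 1, Finset.mem_Iic.2 (Nat.succ_le_succ (Finset.mem_Iic.1 i.2))⟩, p.2)
      have hg : Measurable g := by fun_prop
      have hgA : MeasurableSet (g ⁻¹' A) := hg hA
      have hgr : ∀ (ρ : ℕ → S) (y : S),
          g (Preorder.frestrictLe (π := fun _ : ℕ => S) (a + 1) ρ, y) =
            (Preorder.frestrictLe (π := fun _ : ℕ => S) a (fun n => ρ (n + 1)), y) :=
        fun _ _ => rfl
      have h := T.pathMeasure_frestrictLe_succ μ (a + 1) hgA
      simp only [Set.mem_preimage, hgr] at h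
      exact h
    · have hk : Measurable fun x : (Π _ : Finset.Iic a, S) =>
          T.stepKernel a x (Prod.mk x ⁻¹' A) := Kernel.measurable_kernel_prodMk_left hA
      exact hk.comp (Preorder.measurable_frestrictLe (X := fun _ : ℕ => S) a)

/-- A property that holds almost surely from every initial distribution holds almost surely for
all the shifts of a path. -/
theorem ae_forall_shift {p : (ℕ → S) → Prop}
    (h : ∀ μ : Measure S, IsProbabilityMeasure μ → ∀ᵐ ρ ∂(T.pathMeasure μ), p ρ)
    (μ : Measure S) [IsProbabilityMeasure μ] :
    ∀ᵐ ρ ∂(T.pathMeasure μ), ∀ n, p (fun k => ρ (k + n)) := by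
  rw [ae_all_iff]
  intro n
  induction n generalizing μ with
  | zero => exact h μ inferInstance
  | succ n ih =>
    have hn := ih (T.transform μ)
    rw [← pathMeasure_map_shift] at hn
    have hm : Measurable fun (ρ : ℕ → S) n => ρ (n + 1) := by fun_prop
    exact ae_of_ae_map hm.aemeasurable hn

theorem ae_pathMeasure_of_forall_dirac {p : (ℕ → S) → Prop} (hp : MeasurableSet {ρ | p ρ})
    (h : ∀ x, ∀ᵐ ρ ∂(T.pathMeasure (Measure.dirac x)), p ρ) (μ : Measure S) :
    ∀ᵐ ρ ∂(T.pathMeasure μ), p ρ := by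
  have hp' : MeasurableSet {ρ | ¬p ρ} := hp.compl
  rw [ae_iff, pathMeasure_apply _ _ hp']
  simp_rw [ae_iff] at h
  simp [h]

theorem ae_zero_mem_of_dirac {V : Set S} (hV : MeasurableSet V) {x : S} (hx : x ∈ V) :
    ∀ᵐ ρ ∂(T.pathMeasure (Measure.dirac x)), ρ 0 ∈ V := by
  refine ae_of_ae_map (f := fun ρ : ℕ → S => ρ 0) (p := (· ∈ V))
    (measurable_pi_apply 0).aemeasurable ?_
  rw [pathMeasure_map_zero]
  exact (ae_dirac_iff hV).2 hx

theorem ae_one_of_kernel {p : S → Prop} {x : S} (h : ∀ᵐ y ∂(T.kernel x), p y) :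
    ∀ᵐ ρ ∂(T.pathMeasure (Measure.dirac x)), p (ρ 1) := by
  refine ae_of_ae_map (f := fun ρ : ℕ → S => ρ 1) (p := p)
    (measurable_pi_apply 1).aemeasurable ?_
  rwa [pathMeasure_map_one, transform_dirac]

end Markov

/-! ### Hitting and avoiding sets -/

section Hitting

variable {S : Type*} [MeasurableSpace S] (T : STS S)

theorem measurableSet_hits {U : Set S} (hU : MeasurableSet U) :
    MeasurableSet {ρ : ℕ → S | ∃ n, ρ n ∈ U} := by
  have : {ρ : ℕ → S | ∃ n, ρ n ∈ U} = ⋃ n, (fun ρ => ρ n) ⁻¹' U := by ext; simp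
  rw [this]
  exact .iUnion fun n => measurable_pi_apply n hU

theorem measurableSet_avoids {U : Set S} (hU : MeasurableSet U) :
    MeasurableSet {ρ : ℕ → S | ∀ n, ρ n ∉ U} := by
  have : {ρ : ℕ → S | ∀ n, ρ n ∉ U} = {ρ | ∃ n, ρ n ∈ U}ᶜ := by ext; simp
  rw [this]
  exact (measurableSet_hits hU).compl

theorem measurableSet_avoids_lt {U : Set S} (hU : MeasurableSet U) (n : ℕ) :
    MeasurableSet {ρ : ℕ → S | ∀ k < n, ρ k ∉ U} := by
  have : {ρ : ℕ → S | ∀ k < n, ρ k ∉ U} = ⋂ k, ⋂ (_ : k < n), (fun ρ => ρ k) ⁻¹' Uᶜ := by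
    ext; simp
  rw [this]
  exact .iInter fun k => .iInter fun _ => measurable_pi_apply k hU.compl

theorem pathMeasure_hits_eq_one_iff {U : Set S} (hU : MeasurableSet U) (μ : Measure S)
    [IsProbabilityMeasure μ] :
    T.pathMeasure μ {ρ | ∃ n, ρ n ∈ U} = 1 ↔ ∀ᵐ ρ ∂(T.pathMeasure μ), ∃ n, ρ n ∈ U :=
  (mem_ae_iff_prob_eq_one (measurableSet_hits hU)).symm

/-- First-step analysis. -/
theorem pathMeasure_dirac_shift (x : S) {N : Set (ℕ → S)} (hN : MeasurableSet N) :
    T.pathMeasure (Measure.dirac x) {ρ | (fun n => ρ (n + 1)) ∈ N} =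
      ∫⁻ y, T.pathMeasure (Measure.dirac y) N ∂(T.kernel x) := by
  have hm : Measurable fun (ρ : ℕ → S) n => ρ (n + 1) := by fun_prop
  rw [← pathMeasure_apply _ _ hN, ← transform_dirac, ← pathMeasure_map_shift,
    Measure.map_apply hm hN]
  rfl

/-- The avoidance probability is subharmonic, because avoiding `U` forever entails avoiding it from
time 1 on. -/
theorem pathMeasure_avoids_le (x : S) {U : Set S} (hU : MeasurableSet U) :
    T.pathMeasure (Measure.dirac x) {ρ | ∀ n, ρ n ∉ U} ≤
      ∫⁻ y, T.pathMeasure (Measure.dirac y) {ρ | ∀ n, ρ n ∉ U} ∂(T.kernel x) := by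
  rw [← pathMeasure_dirac_shift _ _ (measurableSet_avoids hU)]
  exact measure_mono fun ρ hρ n => hρ (n + 1)

theorem lintegral_pathMeasure_avoids_lt_le {x : S} {U : Set S} (hU : MeasurableSet U)
    (hx : x ∉ U) (n : ℕ) :
    ∫⁻ y, T.pathMeasure (Measure.dirac y) {ρ | ∀ k < n, ρ k ∉ U} ∂(T.kernel x) ≤
      T.pathMeasure (Measure.dirac x) {ρ | ∀ k < n + 1, ρ k ∉ U} := by
  rw [← pathMeasure_dirac_shift _ _ (measurableSet_avoids_lt hU n)]
  refine measure_mono_ae ?_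
  filter_upwards [T.ae_zero_mem_of_dirac hU.compl hx] with ρ h0 h k hk
  cases k with
  | zero => exact h0
  | succ k => exact h k (by omega)

theorem pathMeasure_avoids_eq_zero_of_mem {x : S} {U : Set S} (hU : MeasurableSet U)
    (hx : x ∈ U) : T.pathMeasure (Measure.dirac x) {ρ | ∀ n, ρ n ∉ U} = 0 := by
  have h : ∀ᵐ ρ ∂(T.pathMeasure (Measure.dirac x)), ¬ ∀ n, ρ n ∉ U := by
    filter_upwards [T.ae_zero_mem_of_dirac hU hx] with ρ h0 h
    exact h 0 h0
  rw [ae_iff] at h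
  simpa using h

/-- If `A` is reached almost surely, then on a set `R` that is never left, the probability of
avoiding `U` is at most its supremum over `A ∩ R`. -/
theorem pathMeasure_avoids_le_of_isAttractor {A U R : Set S} (hA : T.IsAttractor A)
    (hU : MeasurableSet U) (hR : ∀ x ∈ R, ∀ᵐ y ∂(T.kernel x), y ∈ R) {H : ENNReal}
    (hH : ∀ a ∈ A, a ∈ R → T.pathMeasure (Measure.dirac a) {ρ | ∀ n, ρ n ∉ U} ≤ H)
    {x : S} (hx : x ∈ R) :
    T.pathMeasure (Measure.dirac x) {ρ | ∀ n, ρ n ∉ U} ≤ H := by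
  -- Optional stopping at the first visit to `A`, truncated at `n`: the error is the probability of
  -- not having met `A` before time `n`. At `n = 0` it equals 1 and the bound is trivial.
  have key : ∀ n, ∀ x ∈ R, T.pathMeasure (Measure.dirac x) {ρ | ∀ n, ρ n ∉ U} ≤
      H + T.pathMeasure (Measure.dirac x) {ρ | ∀ k < n, ρ k ∉ A} := by
    intro n
    induction n with
    | zero =>
      intro x _
      refine le_trans prob_le_one ?_
      simp
    | succ n ih =>
      intro x hx
      by_cases hxA : x ∈ A
      · exact (hH x hxA hx).trans le_self_add
      · calc _ ≤ ∫⁻ y, T.pathMeasure (Measure.dirac y) {ρ | ∀ n, ρ n ∉ U} ∂(T.kernel x) :=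
              T.pathMeasure_avoids_le x hU
          _ ≤ ∫⁻ y, (H + T.pathMeasure (Measure.dirac y) {ρ | ∀ k < n, ρ k ∉ A})
              ∂(T.kernel x) := by
              refine lintegral_mono_ae ?_
              filter_upwards [hR x hx] with y hy using ih y hy
          _ = H + ∫⁻ y, T.pathMeasure (Measure.dirac y) {ρ | ∀ k < n, ρ k ∉ A}
              ∂(T.kernel x) := by
              rw [lintegral_add_left measurable_const]
              simp
          _ ≤ _ := by
              gcongr
              exact T.lintegral_pathMeasure_avoids_lt_le hA.1 hxA n
  have hlim : Filter.Tendsto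
      (fun n => T.pathMeasure (Measure.dirac x) {ρ | ∀ k < n, ρ k ∉ A}) Filter.atTop
      (nhds (T.pathMeasure (Measure.dirac x) (⋂ n, {ρ | ∀ k < n, ρ k ∉ A}))) :=
    tendsto_measure_iInter_atTop
      (fun n => (measurableSet_avoids_lt hA.1 n).nullMeasurableSet)
      (fun m n hmn ρ h k hk => h k (lt_of_lt_of_le hk hmn)) ⟨0, measure_ne_top _ _⟩
  have h0 : T.pathMeasure (Measure.dirac x) (⋂ n, {ρ | ∀ k < n, ρ k ∉ A}) = 0 := by
    have h := (T.pathMeasure_hits_eq_one_iff hA.1 _).1 (hA.2 (Measure.dirac x) inferInstance)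
    rw [ae_iff] at h
    refine measure_mono_null (fun ρ hρ => ?_) h
    rintro ⟨n, hn⟩
    exact Set.mem_iInter.1 hρ (n + 1) n n.lt_succ_self hn
  rw [h0] at hlim
  have := (tendsto_const_nhds (x := H)).add hlim
  rw [add_zero] at this
  exact ge_of_tendsto' this fun n => key n x hx

end Hitting

/-! ### Maximum principle on countable state spaces -/

section Countable

variable {S : Type*} [MeasurableSpace S] [Countable S] (T : STS S)

theorem ae_kernel_singleton_pos (x : S) : ∀ᵐ y ∂(T.kernel x), 0 < T.kernel x {y} :=
  ae_iff_of_countable.2 fun _ hy => pos_iff_ne_zero.2 hy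

variable [MeasurableSingletonClass S]

/-- If `A` is a finite attractor and `U` can be reached from every state of `A` that can be
reached from `x`, then `U` is almost surely reached from `x`. -/
theorem ae_hits_of_finite_isAttractor {A U : Set S} (hA : T.IsAttractor A) (hfin : A.Finite)
    {x : S} (h : ∀ a ∈ A, T.HasPath x a → ∃ u ∈ U, T.HasPath a u) :
    ∀ᵐ ρ ∂(T.pathMeasure (Measure.dirac x)), ∃ n, ρ n ∈ U := by
  have hU : MeasurableSet U := U.to_countable.measurableSet
  let f : S → ENNReal := fun y => T.pathMeasure (Measure.dirac y) {ρ | ∀ n, ρ n ∉ U}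
  let R : Set S := {y | T.HasPath x y}
  have hR : ∀ y ∈ R, ∀ᵐ z ∂(T.kernel y), z ∈ R := fun y hy => by
    filter_upwards [T.ae_kernel_singleton_pos y] with z hz using Relation.ReflTransGen.tail hy hz
  suffices hx : f x = 0 by
    rw [ae_iff]
    simpa [f] using hx
  by_contra hx
  rcases (A ∩ R).eq_empty_or_nonempty with he | hne
  · refine hx (nonpos_iff_eq_zero.1 (T.pathMeasure_avoids_le_of_isAttractor hA hU hR
      (fun a ha haR => ?_) (show x ∈ R from Relation.ReflTransGen.refl)))
    exact absurd (show a ∈ A ∩ R from ⟨ha, haR⟩) (by simp [he])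
  -- Finiteness of `A` provides a maximum of `f` on `A ∩ R`; by the attractor bound it is a maximum
  -- on all of `R`.
  obtain ⟨a, ⟨haA, haR⟩, hmax⟩ := (hfin.inter_of_left R).exists_maximalFor f _ hne
  have hle : ∀ y ∈ R, f y ≤ f a := fun y hy =>
    T.pathMeasure_avoids_le_of_isAttractor hA hU hR (fun b hb hbR => by
      rcases le_total (f b) (f a) with h | h
      · exact h
      · exact hmax ⟨hb, hbR⟩ h) hy
  have hpos : f a ≠ 0 := fun h0 =>
    hx (nonpos_iff_eq_zero.1 (h0 ▸ hle x Relation.ReflTransGen.refl))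
  have hclosed : ∀ y, T.HasPath a y → f y = f a := by
    intro y hy
    induction hy with
    | refl => rfl
    | @tail y z hay hyz ih =>
      have hyR : y ∈ R := Relation.ReflTransGen.trans haR hay
      -- `f` is at most `f a` almost everywhere, yet its mean is at least `f y = f a`; so equality
      -- holds at every successor of positive probability, and the maximum propagates along paths
      -- until it contradicts `f = 0` on `U`.
      have hae : f =ᵐ[T.kernel y] fun _ => f a := by
        refine ae_eq_of_ae_le_of_lintegral_le ?_ ?_ measurable_const.aemeasurable ?_
        · filter_upwards [hR y hyR] with z hz using hle z hz
        · refine ne_top_of_le_ne_top ENNReal.one_ne_top ?_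
          calc ∫⁻ z, f z ∂(T.kernel y) ≤ ∫⁻ _, 1 ∂(T.kernel y) :=
                lintegral_mono fun z => prob_le_one
            _ = 1 := by simp
        · calc ∫⁻ _, f a ∂(T.kernel y) = f y := by simp [ih]
            _ ≤ _ := T.pathMeasure_avoids_le y hU
      exact ae_iff_of_countable.1 hae z hyz.ne'
  obtain ⟨u, hu, hau⟩ := h a haA haR
  exact hpos ((hclosed u hau).symm.trans (T.pathMeasure_avoids_eq_zero_of_mem hU hu))

end Countable

/-! ### Transfer along abstractions -/

section Abstraction

variable {S₁ S₂ : Type*} [MeasurableSpace S₁] [MeasurableSpace S₂] [Countable S₂]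
  [MeasurableSingletonClass S₂] {β : S₁ → S₂} {T₁ : STS S₁} {T₂ : STS S₂}

theorem IsAbstraction.ae_kernel_pos (h : IsAbstraction β T₁ T₂) (x : S₁) :
    ∀ᵐ y ∂(T₁.kernel x), 0 < T₂.kernel (β x) {β y} := by
  have hN := (h.2 (Measure.dirac x) inferInstance {z | ¬ 0 < T₂.kernel (β x) {z}}
    (Set.to_countable _).measurableSet).2
  rw [Measure.map_dirac' h.1, transform_dirac, transform_dirac] at hN
  exact ae_of_ae_map h.1.aemeasurable (ae_iff.2 (hN (ae_iff.1 (T₂.ae_kernel_singleton_pos _))))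

/-- The image of a path of `T₁` is almost surely a path of `T₂`. -/
theorem IsAbstraction.ae_hasPath (h : IsAbstraction β T₁ T₂) (μ : Measure S₁)
    [IsProbabilityMeasure μ] :
    ∀ᵐ ρ ∂(T₁.pathMeasure μ), ∀ n m, n ≤ m → T₂.HasPath (β (ρ n)) (β (ρ m)) := by
  have hstep : ∀ ν : Measure S₁, IsProbabilityMeasure ν →
      ∀ᵐ ρ ∂(T₁.pathMeasure ν), 0 < T₂.kernel (β (ρ 0)) {β (ρ 1)} := by
    intro ν _
    refine T₁.ae_pathMeasure_of_forall_dirac ?_ (fun x => ?_) ν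
    · have hm : Measurable fun ρ : ℕ → S₁ => (β (ρ 0), β (ρ 1)) :=
        (h.1.comp (measurable_pi_apply 0)).prodMk (h.1.comp (measurable_pi_apply 1))
      exact hm (Set.to_countable {p : S₂ × S₂ | 0 < T₂.kernel p.1 {p.2}}).measurableSet
    · filter_upwards [T₁.ae_zero_mem_of_dirac (h.1 (measurableSet_singleton (β x)))
        (show x ∈ β ⁻¹' {β x} from rfl), T₁.ae_one_of_kernel (h.ae_kernel_pos x)] with ρ h0 h1
      have h0' : β (ρ 0) = β x := h0
      rwa [h0']
  filter_upwards [T₁.ae_forall_shift hstep μ] with ρ hρ n m hnm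
  induction m, hnm using Nat.le_induction with
  | base => exact Relation.ReflTransGen.refl
  | succ m _ ih =>
    have := hρ m
    rw [Nat.zero_add, Nat.add_comm 1 m] at this
    exact Relation.ReflTransGen.tail ih this

/-- Almost sure reachability in `T₂` is inherited by the paths of `T₁` at all times. -/
theorem IsSoundAbstraction.ae_hits (h : IsSoundAbstraction β T₁ T₂) (μ : Measure S₁)
    [IsProbabilityMeasure μ] :
    ∀ᵐ ρ ∂(T₁.pathMeasure μ), ∀ (y t : S₂) (n : ℕ),
      (∀ᵐ σ ∂(T₂.pathMeasure (Measure.dirac y)), ∃ k, σ k ∈ ({t} : Set S₂)) →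
      β (ρ n) = y → ∃ m, n ≤ m ∧ β (ρ m) = t := by
  have hβ : Measurable β := h.1.1
  rw [ae_all_iff]; intro y
  rw [ae_all_iff]; intro t
  by_cases hyt : ∀ᵐ σ ∂(T₂.pathMeasure (Measure.dirac y)), ∃ k, σ k ∈ ({t} : Set S₂)
  swap
  · exact Filter.Eventually.of_forall fun ρ n h => absurd h hyt
  have hstep : ∀ ν : Measure S₁, IsProbabilityMeasure ν →
      ∀ᵐ ρ ∂(T₁.pathMeasure ν), ρ 0 ∈ β ⁻¹' {y} → ∃ n, ρ n ∈ β ⁻¹' {t} := by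
    intro ν _
    refine T₁.ae_pathMeasure_of_forall_dirac ?_ (fun x => ?_) ν
    -- Soundness is invoked only for Dirac initial measures, whose images are again Dirac;
    -- measurability of the event then gives all initial distributions.
    · have h1 : MeasurableSet {ρ : ℕ → S₁ | ρ 0 ∈ β ⁻¹' {y}} :=
        measurable_pi_apply 0 (hβ (measurableSet_singleton y))
      exact h1.imp (measurableSet_hits (hβ (measurableSet_singleton t)))
    · by_cases hx : β x = y
      · have := h.2 (Measure.dirac x) inferInstance {t} (measurableSet_singleton t)
        rw [Measure.map_dirac' hβ, hx, pathMeasure_hits_eq_one_iff _ (measurableSet_singleton t),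
          pathMeasure_hits_eq_one_iff _ (hβ (measurableSet_singleton t))] at this
        filter_upwards [this hyt] with ρ hρ _ using hρ
      · filter_upwards [T₁.ae_zero_mem_of_dirac (hβ (measurableSet_singleton y)).compl
          (show x ∈ (β ⁻¹' {y})ᶜ from hx)] with ρ h0 h1 using absurd h1 h0
  filter_upwards [T₁.ae_forall_shift hstep μ] with ρ hρ n _ hn
  obtain ⟨m, hm⟩ := hρ n (by simpa using hn)
  exact ⟨m + n, Nat.le_add_left _ _, hm⟩

end Abstraction

/-! ### Bottom strongly connected components -/

section BSCC

variable {S : Type*} [MeasurableSpace S] (T : STS S) {B : Set S}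

theorem reflTransGen_graph_adj {v w : B} :
    Relation.ReflTransGen (T.graph B).Adj v w ↔ T.HasPath v w := by
  refine ⟨fun h => ?_, fun h => .single h⟩
  induction h with
  | refl => exact .refl
  | tail _ h ih => exact ih.trans h

/-- The BSCCs of the graph of `B`, as sets of states. -/
def bsccs (B : Set S) : Set (Set S) :=
  {C | ∃ D : Set B, (T.graph B).IsBSCC D ∧ C = Subtype.val '' D}

variable {T}

theorem subset_of_mem_bsccs {C : Set S} (hC : C ∈ T.bsccs B) : C ⊆ B := by
  obtain ⟨D, -, rfl⟩ := hC
  rintro _ ⟨x, -, rfl⟩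
  exact x.2

/-- A BSCC consists of the states of `B` that can be reached from any of its elements. -/
theorem mem_iff_of_mem_bsccs {C : Set S} (hC : C ∈ T.bsccs B) {c b : S} (hc : c ∈ C) :
    b ∈ C ↔ b ∈ B ∧ T.HasPath c b := by
  obtain ⟨D, ⟨⟨v, hv⟩, hD⟩, rfl⟩ := hC
  obtain ⟨c, hc, rfl⟩ := hc
  constructor
  · rintro ⟨b, hb, rfl⟩
    rw [hv] at hb hc
    exact ⟨b.2, (T.reflTransGen_graph_adj.1 hc.2).trans (T.reflTransGen_graph_adj.1 hb.1)⟩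
  · rintro ⟨hb, h⟩
    exact ⟨⟨b, hb⟩, hD c hc ⟨b, hb⟩ h, rfl⟩

theorem eq_of_mem_bsccs {C C' : Set S} (hC : C ∈ T.bsccs B) (hC' : C' ∈ T.bsccs B) {c c' : S}
    (hc : c ∈ C) (hc' : c' ∈ C') (h : T.HasPath c c') : C = C' := by
  have hc'C : c' ∈ C := (mem_iff_of_mem_bsccs hC hc).2 ⟨subset_of_mem_bsccs hC' hc', h⟩
  ext b
  rw [mem_iff_of_mem_bsccs hC hc'C, mem_iff_of_mem_bsccs hC' hc']

/-- In a finite preorder every element lies below a maximal one; for reachability, the class of a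
maximal element is a BSCC. -/
theorem exists_hasPath_mem_bsccs (hB : B.Finite) {a : S} (ha : a ∈ B) :
    ∃ u ∈ ⋃₀ T.bsccs B, T.HasPath a u := by
  let _ : Preorder B :=
    { le := fun x y => T.HasPath x y
      le_refl := fun x => Relation.ReflTransGen.refl
      le_trans := fun x y z => Relation.ReflTransGen.trans }
  have : Finite B := hB
  obtain ⟨v, hav, hv⟩ :=
    (Set.finite_univ (α := B)).exists_le_maximal (Set.mem_univ (⟨a, ha⟩ : B))
  refine ⟨v, ⟨_, ⟨{w | T.HasPath v w ∧ T.HasPath w v}, ⟨⟨v, ?_⟩, ?_⟩, rfl⟩, v, ⟨.refl, .refl⟩,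
    rfl⟩, hav⟩
  · simp_rw [reflTransGen_graph_adj]
  · intro x hx y hxy
    have hvy : T.HasPath v y := Relation.ReflTransGen.trans hx.1 hxy
    exact ⟨hvy, hv.2 (Set.mem_univ y) hvy⟩

variable [Countable S] [MeasurableSingletonClass S]

/-- Any state of `B` met after `y` is reachable from `C`, hence belongs to `C` and leads back to `c`
and on to `t`; the maximum principle applies. -/
theorem ae_hits_of_mem_bsccs (hB : T.IsAttractor B) (hfin : B.Finite) {C : Set S}
    (hC : C ∈ T.bsccs B) {c y t : S} (hc : c ∈ C) (hy : T.HasPath c y) (ht : T.HasPath c t) :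
    ∀ᵐ σ ∂(T.pathMeasure (Measure.dirac y)), ∃ k, σ k ∈ ({t} : Set S) := by
  refine T.ae_hits_of_finite_isAttractor hB hfin fun a ha hya => ⟨t, rfl, ?_⟩
  have haC : a ∈ C := (mem_iff_of_mem_bsccs hC hc).2 ⟨ha, Relation.ReflTransGen.trans hy hya⟩
  exact Relation.ReflTransGen.trans ((mem_iff_of_mem_bsccs hC haC).1 hc).2 ht

theorem ae_hits_sUnion_bsccs (hB : T.IsAttractor B) (hfin : B.Finite) (μ : Measure S) :
    ∀ᵐ σ ∂(T.pathMeasure μ), ∃ k, σ k ∈ ⋃₀ T.bsccs B :=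
  T.ae_pathMeasure_of_forall_dirac (measurableSet_hits (Set.to_countable _).measurableSet)
    (fun _ => T.ae_hits_of_finite_isAttractor hB hfin
      fun _ ha _ => exists_hasPath_mem_bsccs hfin ha) μ

end BSCC

end STS

/-! ### Good components and the Muller condition -/

section Muller

variable {S Q : Type*} [MeasurableSpace S] [MeasurableSpace Q]

/-- The locations that can be reached from `C`. -/
def reachableLocations (T : STS (S × Q)) (C : Set (S × Q)) : Set Q :=
  {q | ∃ s, ∃ c ∈ C, T.HasPath c (s, q)}

/-- The two clauses of goodness are opposite inclusions, so the witness `F` can only be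
`reachableLocations T C`. -/
theorem mem_goodBSCCs_iff {T : STS (S × Q)} {B : Set (S × Q)} {𝓕 : Set (Set Q)}
    {C : Set (S × Q)} :
    C ∈ goodBSCCs T B 𝓕 ↔ C ∈ T.bsccs B ∧ reachableLocations T C ∈ 𝓕 := by
  refine and_congr_right fun _ => ⟨?_, fun h => ⟨_, h, fun s q h => ⟨s, h⟩, fun q h => h⟩⟩
  rintro ⟨F, hF, h1, h2⟩
  have : reachableLocations T C = F :=
    Set.Subset.antisymm (fun q ⟨s, h⟩ => h1 s q h) h2
  rwa [this]

end Muller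

/-! ### Locations visited infinitely often -/

section Main

variable {AP S₁ S₂ Q : Type*} [Finite AP] [MeasurableSpace S₁] [MeasurableSpace S₂]
  [Countable S₂] [DiscreteMeasurableSpace S₂] [Finite Q] [MeasurableSpace Q]
  [DiscreteMeasurableSpace Q] {T₁ : LSTS AP S₁} {T₂ : LSTS AP S₂} {α : S₁ → S₂} {M : DMA AP Q}
  {B : Set (S₂ × Q)}

theorem ae_inf_eq_reachableLocations
    (hsound : STS.IsSoundAbstraction (liftProd Q α) (T₁.product M).toSTS (T₂.product M).toSTS)
    (hfin : B.Finite) (hB : (T₂.product M).toSTS.IsAttractor B)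
    (ν : Measure (S₁ × Q)) [IsProbabilityMeasure ν] :
    ∀ᵐ ρ ∂((T₁.product M).toSTS.pathMeasure ν), ∀ C ∈ (T₂.product M).toSTS.bsccs B,
      (∃ n, ρ n ∈ liftProd Q α ⁻¹' C) →
        (T₁.product M).inf ρ = reachableLocations (T₂.product M).toSTS C := by
  filter_upwards [hsound.1.ae_hasPath ν, hsound.ae_hits ν] with ρ hpath hhit C hC ⟨n, hn⟩
  have hn : liftProd Q α (ρ n) ∈ C := hn
  ext q
  constructor
  · intro hq
    obtain ⟨j, hj, hnj⟩ := Set.Infinite.exists_gt (s := {j | q ∈ (T₁.product M).label (ρ j)}) hq n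
    have hj : q = (ρ j).2 := hj
    refine ⟨α (ρ j).1, _, hn, ?_⟩
    rw [hj]
    exact hpath n j hnj.le
  · rintro ⟨s, c, hc, hcq⟩
    refine Set.infinite_of_forall_exists_gt fun m => ?_
    have hnq := Relation.ReflTransGen.trans ((STS.mem_iff_of_mem_bsccs hC hn).1 hc).2 hcq
    -- Starting after `n` keeps the state reachable from `C`; starting at `m + 1` or later makes `j
    -- > m`.
    obtain ⟨j, hj, hjq⟩ := hhit _ _ (max n (m + 1))
      (STS.ae_hits_of_mem_bsccs hB hfin hC hn (hpath n _ (le_max_left _ _)) hnq) rfl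
    exact ⟨j, (congrArg Prod.snd hjq).symm, lt_of_lt_of_le m.lt_succ_self
      ((le_max_right _ _).trans hj)⟩

end Main

theorem mainTheorem7 {AP S₁ S₂ Q : Type*} [Finite AP]
    [MeasurableSpace S₁]
    [MeasurableSpace S₂] [Countable S₂] [DiscreteMeasurableSpace S₂]
    [Finite Q] [MeasurableSpace Q] [DiscreteMeasurableSpace Q]
    (T₁ : LSTS AP S₁) (T₂ : LSTS AP S₂) (α : S₁ → S₂)
    (habs : LSTS.IsAbstraction α T₁ T₂)
    (hfin : ∃ A : Set S₂, A.Finite ∧ T₂.toSTS.IsAttractor A)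
    (M : DMA AP Q)
    (hsound : STS.IsSoundAbstraction (liftProd Q α)
      (T₁.product M).toSTS (T₂.product M).toSTS)
    (B₂ : Set (S₂ × Q)) (hB₂fin : B₂.Finite)
    (hB₂ : (T₂.product M).toSTS.IsAttractor B₂)
    (μ : Measure S₁) [IsProbabilityMeasure μ] :
    (T₁.product M).toSTS.pathMeasure (μ.prod (Measure.dirac M.init))
        {ρ | (T₁.product M).inf ρ ∈ M.muller} =
      ∑' C : goodBSCCs (T₂.product M).toSTS B₂ M.muller,
        (T₁.product M).toSTS.pathMeasure (μ.prod (Measure.dirac M.init))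
          {ρ | ∃ n, ρ n ∈ liftProd Q α ⁻¹' (C : Set (S₂ × Q))} := by
  have hβ : Measurable (liftProd Q α) := hsound.1.1
  have hpath := hsound.1.ae_hasPath (μ.prod (Measure.dirac M.init))
  have : IsProbabilityMeasure ((μ.prod (Measure.dirac M.init)).map (liftProd Q α)) :=
    Measure.isProbabilityMeasure_map hβ.aemeasurable
  have hU : MeasurableSet (⋃₀ (T₂.product M).toSTS.bsccs B₂) := (Set.to_countable _).measurableSet
  have hbscc := hsound.2 (μ.prod (Measure.dirac M.init)) inferInstance _ hU
  rw [STS.pathMeasure_hits_eq_one_iff _ hU, STS.pathMeasure_hits_eq_one_iff _ (hβ hU)] at hbscc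
  have : Countable (goodBSCCs (T₂.product M).toSTS B₂ M.muller) :=
    (hB₂fin.finite_subsets.subset fun C hC =>
      STS.subset_of_mem_bsccs (mem_goodBSCCs_iff.1 hC).1).countable
  rw [← measure_iUnion₀]
  · refine measure_congr ?_
    filter_upwards [ae_inf_eq_reachableLocations hsound hB₂fin hB₂ (μ.prod (Measure.dirac M.init)),
      hbscc (STS.ae_hits_sUnion_bsccs hB₂ hB₂fin _)] with ρ hinf ⟨n, C, hC, hn⟩
    refine propext ⟨fun h => ?_, fun h => ?_⟩
    · have h : (T₁.product M).inf ρ ∈ M.muller := h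
      rw [hinf C hC ⟨n, hn⟩] at h
      exact Set.mem_iUnion.2 ⟨⟨C, mem_goodBSCCs_iff.2 ⟨hC, h⟩⟩, n, hn⟩
    · obtain ⟨⟨D, hD⟩, hm⟩ := Set.mem_iUnion.1 h
      rw [mem_goodBSCCs_iff] at hD
      change (T₁.product M).inf ρ ∈ M.muller
      rw [hinf D hD.1 hm]
      exact hD.2
  -- The events are disjoint only almost everywhere: a path meeting both BSCCs yields, outside a
  -- null set, a positive-probability path from one to the other, forcing them to coincide.
  · intro C D hCD
    refine measure_mono_null (t := {ρ | ¬ ∀ n m, n ≤ m → (T₂.product M).toSTS.HasPath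
      (liftProd Q α (ρ n)) (liftProd Q α (ρ m))}) ?_ (ae_iff.1 hpath)
    rintro ρ ⟨⟨n, hn⟩, ⟨m, hm⟩⟩ h
    have hC := (mem_goodBSCCs_iff.1 C.2).1
    have hD := (mem_goodBSCCs_iff.1 D.2).1
    rcases le_total n m with hnm | hnm
    · exact hCD (Subtype.ext (STS.eq_of_mem_bsccs hC hD hn hm (h n m hnm)))
    · exact hCD (Subtype.ext (STS.eq_of_mem_bsccs hD hC hm hn (h m n hnm)).symm)
  · intro C
    exact (STS.measurableSet_hits (hβ (Set.to_countable _).measurableSet)).nullMeasurableSet
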